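/- Let $d\ge 2$. For a number field $K$ and a finite set $S$ of places of $K$ (containing the archimedean ones), let $R_S$ be the ring of $S$-integers. A degree $d$ morphism $f:\mathbb{P}^1_K\to\mathbb{P}^1_K$ has simple good reduction outside $S$ if there is an $R_S$-morphism $\mathbb{P}^1_{R_S}\to\mathbb{P}^1_{R_S}$ whose generic fiber is $\mathrm{PGL}_2(K)$-conjugate to $f$. Let $\mathrm{GR}_d^1[\emptyset](K,S)$ be the set of degree $d$ morphisms $f:\mathbb{P}^1_K\to\mathbb{P}^1_K$ that have simple good reduction outside $S$, let $\mathcal{M}_d^1=\mathrm{End}_d^1/\!/\mathrm{SL}_2$ be the moduli space of degree $d$ endomorphisms of $\mathbb{P}^1$ modulo conjugation (the GIT quotient), and define $$\mathrm{ShafDim}_d^1[\emptyset]=\sup_{K,\,S}\ \dim\overline{\mathrm{Image}\bigl(\mathrm{GR}_d^1[\emptyset](K,S)\to\mathcal{M}_d^1\bigr)},$$ where the supremum is over all number fields $K$ and all finite sets $S$ of places of $K$, and the overline denotes Zariski closure. Then $$\mathrm{ShafDim}_d^1[\emptyset]\ \ge\ d .$$ -/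

import Mathlib

open Polynomial NumberField IsDedekindDomain

/-- The binary form `F = ∑ i, c i X^i Y^(d-i)` of degree `d` with coefficient vector `c`,
written in dehomogenized form `F(X, 1) = ∑ i, c i X^i`. -/
noncomputable def formPoly {R : Type*} [CommRing R] {d : ℕ} (c : Fin (d + 1) → R) : R[X] :=
  ∑ i : Fin (d + 1), C (c i) * X ^ (i : ℕ)

/-- The resultant of the two binary forms `F`, `G` of degree `d` whose coefficient vectors are
`c 0`, `c 1`: the `2d × 2d` Sylvester determinant in the formal degrees `(d, d)`. -/
noncomputable def formRes {R : Type*} [CommRing R] {d : ℕ} (c : Fin 2 → Fin (d + 1) → R) : R :=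
  resultant (formPoly (c 0)) (formPoly (c 1)) d d

/-- The coefficient vector of the binary form `F(αX + βY, γX + δY)`, where `F` is the form with
coefficient vector `c` and `φ = (α β; γ δ)`. -/
noncomputable def formSubst {R : Type*} [CommRing R] {d : ℕ} (φ : Matrix (Fin 2) (Fin 2) R)
    (c : Fin (d + 1) → R) : Fin (d + 1) → R :=
  fun j => (∑ i : Fin (d + 1), C (c i) * (C (φ 0 0) * X + C (φ 0 1)) ^ (i : ℕ) *
    (C (φ 1 0) * X + C (φ 1 1)) ^ (d - (i : ℕ))).coeff j

/-- The degree `d` endomorphisms `f = [F : G]` of the projective line over a field `k`, given by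
homogeneous lifts: pairs of forms `F = c 0`, `G = c 1` of degree `d` whose resultant does not
vanish (that is, without a common zero). Two lifts give the same endomorphism if and only
if they are proportional; every notion below is insensitive to rescaling the lift. -/
def EndLift (k : Type*) [Field k] (d : ℕ) : Type _ :=
  {c : Fin 2 → Fin (d + 1) → k // formRes c ≠ 0}

/-- `f` and `g` are conjugate by an element of `PGL_2(k)`: there is `φ` with `f ∘ φ = φ ∘ g` as
self-maps of the projective line, i.e. `g = φ⁻¹ ∘ f ∘ φ`. Since forms are determined only up to
a common factor, the equality holds up to a unit `u`. -/
def EndConj {k : Type*} [Field k] {d : ℕ} (f g : EndLift k d) : Prop :=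
  ∃ (φ : GL (Fin 2) k) (u : kˣ), ∀ i : Fin 2,
    formSubst (φ : Matrix (Fin 2) (Fin 2) k) (f.1 i) =
      (u : k) • ∑ j : Fin 2, (φ : Matrix (Fin 2) (Fin 2) k) i j • g.1 j

/-- The resultant, as a polynomial in the `2(d+1)` coefficients. -/
noncomputable def resPoly (k : Type*) [Field k] (d : ℕ) : MvPolynomial (Fin 2 × Fin (d + 1)) k :=
  formRes fun i j => MvPolynomial.X (i, j)

theorem formPoly_map {R S : Type*} [CommRing R] [CommRing S] (h : R →+* S) {d : ℕ}
    (c : Fin (d + 1) → R) : (formPoly c).map h = formPoly fun j => h (c j) := by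
  simp [formPoly, Polynomial.map_sum]

theorem formRes_map {R S : Type*} [CommRing R] [CommRing S] (h : R →+* S) {d : ℕ}
    (c : Fin 2 → Fin (d + 1) → R) : formRes (fun i j => h (c i j)) = h (formRes c) := by
  rw [formRes, formRes, ← resultant_map_map, formPoly_map, formPoly_map]

theorem eval_resPoly {k : Type*} [Field k] {d : ℕ} (c : Fin 2 → Fin (d + 1) → k) :
    MvPolynomial.eval (fun ij => c ij.1 ij.2) (resPoly k d) = formRes c := by
  rw [resPoly, ← formRes_map]
  simp

theorem formPoly_coeff {R : Type*} [CommRing R] {d : ℕ} (c : Fin (d + 1) → R) (n : ℕ) :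
    (formPoly c).coeff n = if h : n < d + 1 then c ⟨n, h⟩ else 0 := by
  simp only [formPoly, finsetSum_coeff, coeff_C_mul, coeff_X_pow]
  split_ifs with h
  · rw [Finset.sum_eq_single ⟨n, h⟩]
    · simp
    · intro b _ hb
      have : n ≠ b := fun e => hb (Fin.ext e.symm)
      simp [this]
    · simp
  · refine Finset.sum_eq_zero fun i _ => ?_
    have : n ≠ i := by have := i.2; omega
    simp [this]

theorem formPoly_coeff_isHomogeneous {k : Type*} [Field k] {d : ℕ} (a : Fin 2) (n : ℕ) :
    ((formPoly fun j : Fin (d + 1) =>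
      (MvPolynomial.X (a, j) : MvPolynomial (Fin 2 × Fin (d + 1)) k)).coeff n).IsHomogeneous 1 := by
  rw [formPoly_coeff]
  split_ifs
  · exact MvPolynomial.isHomogeneous_X _ _
  · exact MvPolynomial.isHomogeneous_zero _ _ _

theorem resPoly_isHomogeneous (k : Type*) [Field k] (d : ℕ) :
    (resPoly k d).IsHomogeneous (2 * d) := by
  unfold resPoly formRes resultant
  rw [Matrix.det_apply]
  refine MvPolynomial.IsHomogeneous.sum _ _ _ fun σ _ => ?_
  have key : ∀ i j, (sylvester
      (formPoly fun j => (MvPolynomial.X (0, j) : MvPolynomial (Fin 2 × Fin (d + 1)) k))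
      (formPoly fun j => (MvPolynomial.X (1, j) : MvPolynomial (Fin 2 × Fin (d + 1)) k))
      d d i j).IsHomogeneous 1 := by
    intro i j
    induction j using Fin.addCases <;>
    · simp only [sylvester, Matrix.of_apply, Fin.addCases_left, Fin.addCases_right]
      split_ifs
      · exact formPoly_coeff_isHomogeneous _ _
      · exact MvPolynomial.isHomogeneous_zero _ _ _
  have hp := MvPolynomial.IsHomogeneous.prod Finset.univ
    (fun i => sylvester
      (formPoly fun j => (MvPolynomial.X (0, j) : MvPolynomial (Fin 2 × Fin (d + 1)) k))
      (formPoly fun j => (MvPolynomial.X (1, j) : MvPolynomial (Fin 2 × Fin (d + 1)) k))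
      d d (σ i) i) (fun _ => 1) fun i _ => key _ _
  simp only [Finset.sum_const, Finset.card_univ, Fintype.card_fin, smul_eq_mul, mul_one,
    ← two_mul] at hp
  rcases Int.units_eq_one_or (Equiv.Perm.sign σ) with h | h
  · simpa [h] using hp
  · simpa [h] using hp.neg

/-- The coordinate ring of `End_d`, the complement of the hypersurface `Res = 0` in the projective
space of dimension `2d + 1`, over an algebraically closed field `k`. Its elements are the functions
`P / Res^n` with `P` homogeneous of degree `2dn = deg (Res^n)` in the coefficients. -/
noncomputable def endCoordRing (k : Type*) [Field k] (d : ℕ) : Subalgebra k (EndLift k d → k) where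
  carrier := {g | ∃ (n : ℕ) (P : MvPolynomial (Fin 2 × Fin (d + 1)) k),
    P.IsHomogeneous (2 * d * n) ∧
      ∀ f : EndLift k d, g f = MvPolynomial.eval (fun ij => f.1 ij.1 ij.2) P / formRes f.1 ^ n}
  mul_mem' := by
    rintro a b ⟨m, P, hP, ha⟩ ⟨n, Q, hQ, hb⟩
    refine ⟨m + n, P * Q, ?_, fun f => ?_⟩
    · rw [mul_add]
      exact hP.mul hQ
    · rw [Pi.mul_apply, ha, hb, map_mul, pow_add, div_mul_div_comm]
  add_mem' := by
    rintro a b ⟨m, P, hP, ha⟩ ⟨n, Q, hQ, hb⟩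
    refine ⟨m + n, P * resPoly k d ^ n + Q * resPoly k d ^ m, ?_, fun f => ?_⟩
    · refine MvPolynomial.IsHomogeneous.add ?_ ?_
      · rw [mul_add]
        exact hP.mul ((resPoly_isHomogeneous k d).pow n)
      · rw [add_comm m n, mul_add]
        exact hQ.mul ((resPoly_isHomogeneous k d).pow m)
    · have h := f.2
      rw [Pi.add_apply, ha, hb, map_add, map_mul, map_mul, map_pow, map_pow, eval_resPoly]
      field_simp
      ring
  algebraMap_mem' r := by
    refine ⟨0, MvPolynomial.C r, ?_, fun f => ?_⟩
    · simpa using MvPolynomial.isHomogeneous_C _ r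
    · simp

/-- The ring of conjugation-invariant regular functions on `End_d`. Over an algebraically closed
field, `SL_2(k)` and `GL_2(k)` have the same image `PGL_2(k)`, so these are
the `SL_2`-invariants. -/
noncomputable def moduliCoordRing (k : Type*) [Field k] (d : ℕ) :
    Subalgebra k (EndLift k d → k) where
  carrier := {g | g ∈ endCoordRing k d ∧ ∀ f f' : EndLift k d, EndConj f f' → g f = g f'}
  mul_mem' := by
    rintro a b ⟨ha, ha'⟩ ⟨hb, hb'⟩
    refine ⟨mul_mem ha hb, fun f f' h => ?_⟩
    rw [Pi.mul_apply, Pi.mul_apply, ha' f f' h, hb' f f' h]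
  add_mem' := by
    rintro a b ⟨ha, ha'⟩ ⟨hb, hb'⟩
    refine ⟨add_mem ha hb, fun f f' h => ?_⟩
    rw [Pi.add_apply, Pi.add_apply, ha' f f' h, hb' f f' h]
  algebraMap_mem' r := ⟨Subalgebra.algebraMap_mem _ r, fun _ _ _ => rfl⟩

/-- The moduli space `M_d^1 = End_d // SL_2` over an algebraically closed field `k`: the GIT
quotient of the affine variety `End_d`, i.e. the prime spectrum (with its Zariski topology) of the
ring of invariant regular functions. -/
abbrev ModuliSpace (k : Type*) [Field k] (d : ℕ) : Type _ :=
  PrimeSpectrum (moduliCoordRing k d)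

/-- The quotient map `End_d(k) → M_d^1`: the class of `f` is the maximal ideal of the invariant
functions that vanish at `f`. -/
noncomputable def moduliPoint {k : Type*} [Field k] {d : ℕ} (f : EndLift k d) : ModuliSpace k d :=
  ⟨RingHom.ker ((Pi.evalRingHom (fun _ : EndLift k d => k) f).comp
    (moduliCoordRing k d).subtype), RingHom.ker_isPrime _⟩

/-- Base change of an endomorphism along a field extension. -/
noncomputable def EndLift.baseChange {k : Type*} [Field k] (L : Type*) [Field L] [Algebra k L]
    {d : ℕ} (f : EndLift k d) : EndLift L d :=
  ⟨fun i j => algebraMap k L (f.1 i j), by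
    rw [formRes_map]
    simpa using f.2⟩

/-- `g` extends to an endomorphism of the projective line over the ring of integers localized at
`v`: some rescaling of the pair of forms has `v`-integral coefficients and resultant a `v`-adic
unit (equivalently, the reduced forms have no common zero, so that `g` reduces to a map of the same
degree). -/
def ExtendsAt {K : Type*} [Field K] [NumberField K] {d : ℕ} (v : HeightOneSpectrum (𝓞 K))
    (g : EndLift K d) : Prop :=
  ∃ u : Kˣ, (∀ i j, v.valuation K ((u : K) * g.1 i j) ≤ 1) ∧
    v.valuation K (formRes fun i j => (u : K) * g.1 i j) = 1

/-- `f` has (simple) good reduction outside `S`: some `PGL_2(K)`-conjugate `g` of `f` extends to an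
endomorphism of the projective line over the ring of `S`-integers. Extensions are unique, hence glue,
so this means that the single map `g` extends at every prime outside `S`. -/
def HasGoodReductionOutside {K : Type*} [Field K] [NumberField K] {d : ℕ}
    (S : Set (HeightOneSpectrum (𝓞 K))) (f : EndLift K d) : Prop :=
  ∃ g : EndLift K d, EndConj f g ∧ ∀ v, v ∉ S → ExtendsAt v g

/-- The image in `M_d^1` (over the algebraic closure of `K`) of the set of degree `d` endomorphisms
of the projective line over `K` that have simple good reduction outside `S`. -/
def goodReductionImage (K : Type*) [Field K] [NumberField K] (S : Set (HeightOneSpectrum (𝓞 K)))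
    (d : ℕ) : Set (ModuliSpace (AlgebraicClosure K) d) :=
  {x | ∃ f : EndLift K d, HasGoodReductionOutside S f ∧
    x = moduliPoint (f.baseChange (AlgebraicClosure K))}

/-- The Shafarevich dimension `ShafDim_d^1[∅]` of the empty portrait: the supremum, over all number
fields `K` and all finite sets `S` of places of `K`, of the dimension of the Zariski closure in
`M_d^1` of the set of maps over `K` with simple good reduction outside `S`. Archimedean places
impose no condition, so `S` is given by its finite places. -/
noncomputable def shafDimEmpty (d : ℕ) : WithBot ℕ∞ :=
  ⨆ (K : Type) (_ : Field K) (_ : NumberField K) (S : Finset (HeightOneSpectrum (𝓞 K))),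
    topologicalKrullDim (closure (goodReductionImage K (S : Set (HeightOneSpectrum (𝓞 K))) d))

/-! Consider the maps `c / G` with `c ≠ 0` and `G` monic of degree `d`. The resultant is `±c ^ d`,
so for `c = 1` and integral `G` there is good reduction at every prime; `K = ℚ` and `S = ∅` suffice.
Integer points are Zariski dense among the monic `G`, and over an algebraically closed field the
scaling `x ↦ a x` with `a ^ (d + 1) = c` conjugates `c / G` to some `1 / G`. Hence an invariant
function that vanishes on the good reduction locus vanishes on the whole family
(`eq_zero_of_forall_int`).

It remains to bound the dimension of the image of the family from below by a chain of `d + 1`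
primes. The family is parametrized by its fixed points, the nonzero roots `r i` of `X G - c`, and
`strataIdeal` cuts out the closure of the image of the locus where the first `m` of them equal `1`.
These ideals are prime because each locus is a torus, and they increase with `m`.

Strictness for `m = 1, …, d` needs invariants that detect collisions of fixed points. A fixed point
is multiple exactly when its multiplier `λ` is `1`, so the order of vanishing at `s = 0` of `∏ (s -
(1 - λ_P))` serves. To have this polynomial for all maps without using roots, take the resultant of
`t • (F, G) + D • (X, Y)`, where `D` is the divergence. At a fixed point with `(F, G) = μ (x, y)`,
the Jacobian has radial eigenvalue `d μ` and trace `D`, so `D = μ (λ + d)`; with `t = s - (d + 1)`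
the twisted pair is there `μ (s - (1 - λ)) (x, y)`. Divergence and resultant are covariant, so the
coefficients divided by the resultant lie in the moduli ring (`multiplierCoeff_mem`). -/

/-! ### Linear substitution in binary forms, dehomogenized. -/

section Substitution

variable {R : Type*} [CommRing R]

/-- The linear form with coefficients the `i`-th row of `φ`, dehomogenized. -/
noncomputable def rowForm (φ : Matrix (Fin 2) (Fin 2) R) (i : Fin 2) : R[X] :=
  C (φ i 0) * X + C (φ i 1)

/-- The substitution `P ↦ P(αX + βY, γX + δY)` on forms of degree `n`, dehomogenized. -/
noncomputable def linSubst (φ : Matrix (Fin 2) (Fin 2) R) (n : ℕ) : R[X] →ₗ[R] R[X] :=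
  (MvPolynomial.aeval (rowForm φ)).toLinearMap ∘ₗ homogenizeLM n

theorem linSubst_apply (φ : Matrix (Fin 2) (Fin 2) R) (n : ℕ) (p : R[X]) :
    linSubst φ n p = MvPolynomial.aeval (rowForm φ) (p.homogenize n) := rfl

theorem linSubst_C_mul (φ : Matrix (Fin 2) (Fin 2) R) (n : ℕ) (a : R) (p : R[X]) :
    linSubst φ n (C a * p) = C a * linSubst φ n p := by
  rw [C_mul', map_smul, C_mul']

theorem linSubst_X_pow (φ : Matrix (Fin 2) (Fin 2) R) {m n : ℕ} (h : m ≤ n) :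
    linSubst φ n (X ^ m) = rowForm φ 0 ^ m * rowForm φ 1 ^ (n - m) := by
  simp [linSubst_apply, homogenize_X_pow h]

theorem linSubst_mul (φ : Matrix (Fin 2) (Fin 2) R) {m n : ℕ} {p q : R[X]}
    (hp : p.natDegree ≤ m) (hq : q.natDegree ≤ n) :
    linSubst φ (m + n) (p * q) = linSubst φ m p * linSubst φ n q := by
  simp [linSubst_apply, homogenize_mul p q hp hq]

theorem linSubst_X_mul (φ : Matrix (Fin 2) (Fin 2) R) {n : ℕ} {p : R[X]} (hp : p.natDegree ≤ n) :
    linSubst φ (n + 1) (X * p) = rowForm φ 0 * linSubst φ n p := by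
  rw [add_comm, linSubst_mul φ natDegree_X_le hp]
  simp [linSubst_apply]

theorem linSubst_succ (φ : Matrix (Fin 2) (Fin 2) R) {n : ℕ} {p : R[X]} (hp : p.natDegree ≤ n) :
    linSubst φ (n + 1) p = rowForm φ 1 * linSubst φ n p := by
  conv_lhs => rw [← one_mul p, add_comm, linSubst_mul φ (natDegree_one.le.trans zero_le_one) hp]
  simp [linSubst_apply]

theorem natDegree_rowForm_le (φ : Matrix (Fin 2) (Fin 2) R) (i : Fin 2) :
    (rowForm φ i).natDegree ≤ 1 := natDegree_linear_le

theorem natDegree_linSubst_le (φ : Matrix (Fin 2) (Fin 2) R) (n : ℕ) (p : R[X]) :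
    (linSubst φ n p).natDegree ≤ n := by
  rw [linSubst_apply, homogenize, map_sum]
  refine natDegree_sum_le_of_forall_le _ _ fun kl hkl => ?_
  rw [Finset.HasAntidiagonal.mem_antidiagonal] at hkl
  rw [Finsupp.update_eq_add_single (by simp), MvPolynomial.monomial_single_add,
    ← MvPolynomial.C_mul_X_pow_eq_monomial]
  simp only [map_mul, map_pow, MvPolynomial.aeval_X, MvPolynomial.aeval_C, algebraMap_eq]
  have h0 := natDegree_pow_le_of_le kl.1 (natDegree_rowForm_le φ 0)
  have h1 := natDegree_pow_le_of_le kl.2 (natDegree_rowForm_le φ 1)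
  have := natDegree_mul_le_of_le h0 ((natDegree_C_mul_le (p.coeff kl.1) _).trans h1)
  omega

theorem linSubst_linSubst (φ ψ : Matrix (Fin 2) (Fin 2) R) (n : ℕ) (p : R[X]) :
    linSubst ψ n (linSubst φ n p) = linSubst (φ * ψ) n p := by
  let ℓ : Fin 2 → MvPolynomial (Fin 2) R := fun i =>
    MvPolynomial.C (φ i 0) * MvPolynomial.X 0 + MvPolynomial.C (φ i 1) * MvPolynomial.X 1
  have hℓ : ∀ i, (ℓ i).IsHomogeneous 1 := fun i =>
    (MvPolynomial.isHomogeneous_C_mul_X _ _).add (MvPolynomial.isHomogeneous_C_mul_X _ _)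
  -- Homogenization undoes the dehomogenization, so the composite becomes a composite of
  -- substitutions in two variables.
  have key : (linSubst φ n p).homogenize n = MvPolynomial.aeval ℓ (p.homogenize n) := by
    apply homogenize_eq_of_isHomogeneous
    · simpa using (isHomogeneous_homogenize p).aeval ℓ hℓ
    · rw [linSubst_apply, ← AlgHom.comp_apply]
      congr 1
      ext i
      simp [ℓ, rowForm]
  rw [linSubst_apply, key, linSubst_apply, ← AlgHom.comp_apply]
  congr 1
  apply MvPolynomial.algHom_ext
  intro i
  simp [ℓ, rowForm, Matrix.mul_apply, Fin.sum_univ_two]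
  ring

theorem linSubst_one {n : ℕ} {p : R[X]} (hp : p.natDegree ≤ n) : linSubst 1 n p = p := by
  rw [linSubst_apply]
  convert! aeval_homogenize_X_one p hp using 3
  rw [funext_iff, Fin.forall_fin_two]
  constructor <;> simp [rowForm]

/-- Chain rule for `∂/∂X`. By Euler's identity, `(n + 1) p - X p'` is the dehomogenized `∂/∂Y` of a
form of degree `n + 1`. -/
theorem derivative_linSubst (φ : Matrix (Fin 2) (Fin 2) R) {n : ℕ} {p : R[X]}
    (hp : p.natDegree ≤ n + 1) :
    derivative (linSubst φ (n + 1) p) = C (φ 0 0) * linSubst φ n (derivative p) +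
      C (φ 1 0) * linSubst φ n (C (n + 1 : R) * p - X * derivative p) := by
  refine induction_with_natDegree_le (fun p => derivative (linSubst φ (n + 1) p) =
    C (φ 0 0) * linSubst φ n (derivative p) +
      C (φ 1 0) * linSubst φ n (C (n + 1 : R) * p - X * derivative p)) (n + 1) ?_ ?_ ?_ p hp
  · simp
  · intro k a _ hk
    have h1 : derivative (C a * X ^ k : R[X]) = C (a * k) * X ^ (k - 1) := by
      rw [derivative_C_mul_X_pow]
    have h2 : C (n + 1 : R) * (C a * X ^ k) - X * derivative (C a * X ^ k : R[X]) =
        C (a * ((n + 1 - k : ℕ) : R)) * X ^ k := by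
      rw [h1]
      rcases k with _ | k
      · simp; ring
      · rw [Nat.cast_sub hk]; simp; ring
    rw [h2, h1]
    simp only [linSubst_C_mul]
    have hd : ∀ i, derivative (rowForm φ i) = C (φ i 0) := fun i => by simp [rowForm]
    rw [linSubst_X_pow φ hk, linSubst_X_pow φ (by omega : k - 1 ≤ n), derivative_C_mul,
      derivative_mul, derivative_pow, derivative_pow, hd, hd]
    rcases hk.lt_or_eq with hk | rfl
    · rw [linSubst_X_pow φ (by omega : k ≤ n)]
      rcases k with _ | k
      · simp; ring
      · rw [show n + 1 - (k + 1) = n - (k + 1) + 1 by omega,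
          show n - (k + 1 - 1) = n - (k + 1) + 1 by omega]
        simp; ring
    · simp; ring
  · intro p q _ _ hp hq
    simp only [map_add, hp, hq, mul_add, add_sub_add_comm]
    ring

/-- Euler's identity, transported by the substitution. -/
theorem mul_linSubst_eq (φ : Matrix (Fin 2) (Fin 2) R) {n : ℕ} {p : R[X]}
    (hp : p.natDegree ≤ n + 1) (hp' : (C (n + 1 : R) * p - X * derivative p).natDegree ≤ n) :
    C (n + 1 : R) * linSubst φ (n + 1) p = rowForm φ 0 * linSubst φ n (derivative p) +
      rowForm φ 1 * linSubst φ n (C (n + 1 : R) * p - X * derivative p) := by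
  rw [← linSubst_X_mul φ ((natDegree_derivative_le p).trans (by omega)), ← linSubst_succ φ hp',
    ← map_add, ← linSubst_C_mul]
  congr 1
  ring

theorem natDegree_formPoly_le {d : ℕ} (c : Fin (d + 1) → R) : (formPoly c).natDegree ≤ d := by
  refine natDegree_sum_le_of_forall_le _ _ fun i _ => (natDegree_C_mul_X_pow_le _ _).trans ?_
  omega

theorem formPoly_coeff_of_natDegree_le {d : ℕ} {p : R[X]} (hp : p.natDegree ≤ d) :
    formPoly (fun j : Fin (d + 1) => p.coeff j) = p := by
  ext n
  rw [formPoly_coeff]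
  split_ifs with h
  · rfl
  · exact (coeff_eq_zero_of_natDegree_lt (by omega)).symm

theorem coeff_formPoly {d : ℕ} (c : Fin (d + 1) → R) (j : Fin (d + 1)) :
    (formPoly c).coeff j = c j := by
  rw [formPoly_coeff, dif_pos j.2]

theorem formPoly_injective {d : ℕ} :
    Function.Injective (formPoly : (Fin (d + 1) → R) → R[X]) := fun a b h => by
  ext j
  rw [← coeff_formPoly a, h, coeff_formPoly]

theorem formPoly_sum_smul {d : ℕ} (a : Fin 2 → R) (c : Fin 2 → Fin (d + 1) → R) :
    formPoly (∑ j, a j • c j) = ∑ j, C (a j) * formPoly (c j) := by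
  ext n
  simp only [finsetSum_coeff, coeff_C_mul, formPoly_coeff]
  split_ifs <;> simp

theorem formPoly_formSubst {d : ℕ} (φ : Matrix (Fin 2) (Fin 2) R) (c : Fin (d + 1) → R) :
    formPoly (formSubst φ c) = linSubst φ d (formPoly c) := by
  have : linSubst φ d (formPoly c) = ∑ i : Fin (d + 1), C (c i) *
      (C (φ 0 0) * X + C (φ 0 1)) ^ (i : ℕ) * (C (φ 1 0) * X + C (φ 1 1)) ^ (d - (i : ℕ)) := by
    rw [formPoly, map_sum]
    refine Finset.sum_congr rfl fun i _ => ?_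
    rw [linSubst_C_mul, linSubst_X_pow φ (by omega), mul_assoc]
    rfl
  unfold formSubst
  rw [← this]
  exact formPoly_coeff_of_natDegree_le (natDegree_linSubst_le _ _ _)

end Substitution

/-! ### Covariance of the resultant. -/

section Covariance

variable {R : Type*} [CommRing R]

/-- Linear substitution as an endomorphism of the space of polynomials of degree at most `n`. -/
noncomputable def linSubstLT (φ : Matrix (Fin 2) (Fin 2) R) (n : ℕ) :
    Module.End R (degreeLT R (n + 1)) :=
  (linSubst φ n).restrict fun p _ => by
    rw [mem_degreeLT]
    exact (degree_le_of_natDegree_le (natDegree_linSubst_le φ n p)).trans_lt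
      (by exact_mod_cast Nat.lt_succ_self n)

theorem natDegree_le_of_mem_degreeLT {n : ℕ} {p : R[X]} (hp : p ∈ degreeLT R (n + 1)) :
    p.natDegree ≤ n := by
  rw [degreeLT_succ_eq_degreeLE, mem_degreeLE] at hp
  exact natDegree_le_of_degree_le hp

theorem linSubstLT_mul (φ ψ : Matrix (Fin 2) (Fin 2) R) (n : ℕ) :
    linSubstLT ψ n * linSubstLT φ n = linSubstLT (φ * ψ) n := by
  ext p : 2
  exact linSubst_linSubst φ ψ n p

theorem linSubstLT_one (n : ℕ) : linSubstLT (1 : Matrix (Fin 2) (Fin 2) R) n = 1 := by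
  ext p : 2
  exact linSubst_one (natDegree_le_of_mem_degreeLT p.2)

theorem isUnit_linSubstLT {φ : Matrix (Fin 2) (Fin 2) R} (h : IsUnit φ) (n : ℕ) :
    IsUnit (linSubstLT φ n) := by
  obtain ⟨ψ, h₁, h₂⟩ := isUnit_iff_exists.1 h
  refine isUnit_iff_exists.2 ⟨linSubstLT ψ n, ?_, ?_⟩
  · rw [linSubstLT_mul, h₂, linSubstLT_one]
  · rw [linSubstLT_mul, h₁, linSubstLT_one]

theorem isUnit_prodMap {M : Type*} [AddCommGroup M] [Module R M] {e : Module.End R M}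
    (h : IsUnit e) : IsUnit (LinearMap.prodMap e e : Module.End R (M × M)) := by
  obtain ⟨f, h₁, h₂⟩ := isUnit_iff_exists.1 h
  refine isUnit_iff_exists.2 ⟨LinearMap.prodMap f f, ?_, ?_⟩
  · rw [LinearMap.prodMap_mul, h₁, LinearMap.prodMap_one]
  · rw [LinearMap.prodMap_mul, h₂, LinearMap.prodMap_one]

theorem formRes_eq_det {d : ℕ} (c : Fin 2 → Fin (d + 1) → R) :
    formRes c = (LinearMap.toMatrix
      (((degreeLT.basis R d).prod (degreeLT.basis R d)).reindex finSumFinEquiv)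
      (degreeLT.basis R (d + d)) (sylvesterMap (formPoly (c 0)) (formPoly (c 1))
        (natDegree_formPoly_le _) (natDegree_formPoly_le _))).det := by
  rw [toMatrix_sylvesterMap', formRes, resultant]

/-- The resultant of a pair of forms is multiplied by a unit under a linear change of variables. -/
theorem exists_formRes_formSubst {φ : Matrix (Fin 2) (Fin 2) R} (hφ : IsUnit φ) (d : ℕ) :
    ∃ ω : Rˣ, ∀ c : Fin 2 → Fin (d + 1) → R,
      formRes (fun i => formSubst φ (c i)) = ω * formRes c := by
  rcases d with _ | n
  · refine ⟨1, fun c => ?_⟩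
    simp [formRes]
  let b₁ := ((degreeLT.basis R (n + 1)).prod (degreeLT.basis R (n + 1))).reindex finSumFinEquiv
  let b₂ := degreeLT.basis R (n + 1 + (n + 1))
  -- The Sylvester map `(p, q) ↦ F q + G p` intertwines substitution on cofactor pairs (degree at
  -- most `n`) with substitution on its target (degree at most `2 n + 1`); `ω` is the quotient of
  -- the two determinants.
  let ρ := (linSubstLT φ n).prodMap (linSubstLT φ n)
  let ρ' := linSubstLT φ (n + 1 + n)
  have hρ : IsUnit (LinearMap.toMatrix b₁ b₁ ρ).det := by
    rw [LinearMap.det_toMatrix]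
    exact (isUnit_prodMap (isUnit_linSubstLT hφ n)).map LinearMap.det
  have hρ' : IsUnit (LinearMap.toMatrix b₂ b₂ ρ').det := by
    rw [LinearMap.det_toMatrix]
    exact (isUnit_linSubstLT hφ _).map LinearMap.det
  refine ⟨hρ'.unit * hρ.unit⁻¹, fun c => ?_⟩
  rw [Units.val_mul, mul_right_comm, Units.eq_mul_inv_iff_mul_eq]
  simp only [IsUnit.unit_spec]
  rw [formRes_eq_det, formRes_eq_det, ← Matrix.det_mul, ← Matrix.det_mul]
  change (LinearMap.toMatrix b₁ b₂ _ * LinearMap.toMatrix b₁ b₁ ρ).det =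
    (LinearMap.toMatrix b₂ b₂ ρ' * LinearMap.toMatrix b₁ b₂ _).det
  rw [← LinearMap.toMatrix_comp, ← LinearMap.toMatrix_comp]
  congr 2
  refine LinearMap.ext fun ⟨p, q⟩ => Subtype.ext ?_
  have hp := natDegree_le_of_mem_degreeLT p.2
  have hq := natDegree_le_of_mem_degreeLT q.2
  change formPoly (formSubst φ (c 0)) * linSubst φ n q + formPoly (formSubst φ (c 1)) *
    linSubst φ n p = linSubst φ (n + 1 + n) (formPoly (c 0) * q + formPoly (c 1) * p)
  rw [map_add, linSubst_mul φ (natDegree_formPoly_le _) hq,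
    linSubst_mul φ (natDegree_formPoly_le _) hp, formPoly_formSubst, formPoly_formSubst]

/-- The resultant of a pair of forms is multiplied by a unit under an invertible linear
combination of the pair. -/
theorem exists_formRes_sum_smul {ψ : Matrix (Fin 2) (Fin 2) R} (hψ : IsUnit ψ) (d : ℕ) :
    ∃ ω : Rˣ, ∀ c : Fin 2 → Fin (d + 1) → R,
      formRes (fun i => ∑ j, ψ i j • c j) = ω * formRes c := by
  let b₁ := ((degreeLT.basis R d).prod (degreeLT.basis R d)).reindex finSumFinEquiv
  -- Mixing `F` and `G` is absorbed by mixing the cofactors. The indices are swapped because `F`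
  -- multiplies the second cofactor.
  let N (M : Matrix (Fin 2) (Fin 2) R) : Module.End R (degreeLT R d × degreeLT R d) :=
    LinearMap.prod (M 1 1 • LinearMap.fst R _ _ + M 0 1 • LinearMap.snd R _ _)
      (M 1 0 • LinearMap.fst R _ _ + M 0 0 • LinearMap.snd R _ _)
  have hN : ∀ A B, N A * N B = N (B * A) := fun A B => by
    refine LinearMap.ext fun ⟨p, q⟩ => ?_
    simp only [N, Module.End.mul_apply, LinearMap.prod_apply, Function.prod, LinearMap.add_apply,
      LinearMap.smul_apply, LinearMap.fst_apply, LinearMap.snd_apply, Matrix.mul_apply,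
      Fin.sum_univ_two]
    ext1 <;> dsimp only <;> module
  have hN1 : N 1 = 1 := by
    refine LinearMap.ext fun ⟨p, q⟩ => ?_
    simp [N]
  have hu : IsUnit (LinearMap.toMatrix b₁ b₁ (N ψ)).det := by
    rw [LinearMap.det_toMatrix]
    obtain ⟨χ, h₁, h₂⟩ := isUnit_iff_exists.1 hψ
    exact (isUnit_iff_exists.2 ⟨N χ, by rw [hN, h₂, hN1], by rw [hN, h₁, hN1]⟩ :
      IsUnit (N ψ)).map LinearMap.det
  refine ⟨hu.unit, fun c => ?_⟩
  rw [IsUnit.unit_spec, formRes_eq_det, formRes_eq_det, mul_comm, ← Matrix.det_mul,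
    ← LinearMap.toMatrix_comp]
  congr 2
  refine LinearMap.ext fun ⟨p, q⟩ => Subtype.ext ?_
  change formPoly (∑ j, ψ 0 j • c j) * q + formPoly (∑ j, ψ 1 j • c j) * p =
    formPoly (c 0) * ((ψ 1 0 • (p : R[X])) + ψ 0 0 • (q : R[X])) +
    formPoly (c 1) * ((ψ 1 1 • (p : R[X])) + ψ 0 1 • (q : R[X]))
  rw [formPoly_sum_smul (ψ 0), formPoly_sum_smul (ψ 1)]
  simp only [Fin.sum_univ_two, ← C_mul']
  ring

end Covariance

/-! ### The divergence and the twisted pair. -/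

section Divergence

variable {R : Type*} [CommRing R] {d : ℕ}

/-- The divergence `∂F/∂X + ∂G/∂Y` of a pair of forms `F`, `G` of degree `d`, dehomogenized. -/
noncomputable def divergence (c : Fin 2 → Fin (d + 1) → R) : R[X] :=
  derivative (formPoly (c 0)) + (C (d : R) * formPoly (c 1) - X * derivative (formPoly (c 1)))

/-- The coefficients of `X ^ (n + 1)` cancel, as befits a partial derivative in `Y`. -/
theorem natDegree_euler_le {n : ℕ} {p : R[X]} (hp : p.natDegree ≤ n + 1) :
    (C (n + 1 : R) * p - X * derivative p).natDegree ≤ n := by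
  rw [natDegree_le_iff_coeff_eq_zero]
  intro k hk
  obtain ⟨k, rfl⟩ : ∃ l, k = l + 1 := ⟨k - 1, by omega⟩
  rw [coeff_sub, coeff_C_mul, coeff_X_mul, coeff_derivative]
  rcases (Nat.lt_succ_iff.1 hk).eq_or_lt with rfl | h
  · ring
  · rw [coeff_eq_zero_of_natDegree_lt (by omega)]
    ring

theorem natDegree_divergence_le {n : ℕ} (c : Fin 2 → Fin (n + 1 + 1) → R) :
    (divergence c).natDegree ≤ n := by
  refine natDegree_add_le_of_degree_le ?_ ?_
  · exact (natDegree_derivative_le _).trans (by have := natDegree_formPoly_le (c 0); omega)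
  · rw [Nat.cast_add, Nat.cast_one]
    exact natDegree_euler_le (natDegree_formPoly_le _)

/-- The pair of forms `t • (F, G) + div (F, G) • (X, Y)`. -/
noncomputable def divTwist (t : R) (c : Fin 2 → Fin (d + 1) → R) : Fin 2 → Fin (d + 1) → R :=
  fun i j => (C t * formPoly (c i) + rowForm 1 i * divergence c).coeff j

theorem rowForm_one_zero : rowForm (1 : Matrix (Fin 2) (Fin 2) R) 0 = X := by simp [rowForm]

theorem rowForm_one_one : rowForm (1 : Matrix (Fin 2) (Fin 2) R) 1 = 1 := by simp [rowForm]

theorem formPoly_divTwist {n : ℕ} (t : R) (c : Fin 2 → Fin (n + 1 + 1) → R) (i : Fin 2) :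
    formPoly (divTwist t c i) = C t * formPoly (c i) + rowForm 1 i * divergence c := by
  refine formPoly_coeff_of_natDegree_le (natDegree_add_le_of_degree_le ?_ ?_)
  · exact (natDegree_C_mul_le _ _).trans (natDegree_formPoly_le _)
  · exact (natDegree_mul_le_of_le (natDegree_rowForm_le 1 i) (natDegree_divergence_le c)).trans
      (add_comm 1 n).le

theorem divTwist_map {S : Type*} [CommRing S] (h : R →+* S) (t : R)
    (c : Fin 2 → Fin (d + 1) → R) :
    divTwist (h t) (fun i j => h (c i j)) = fun i j => h (divTwist t c i j) := by
  funext i j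
  simp only [divTwist, ← coeff_map, divergence, rowForm, Polynomial.map_add, Polynomial.map_mul,
    Polynomial.map_sub, map_C, map_X, ← derivative_map, formPoly_map, map_natCast]
  congr
  · simp [Matrix.one_apply, apply_ite h]
  · simp [Matrix.one_apply, apply_ite h]
  · simp

/-- The divergence is covariant under conjugation. -/
theorem linSubst_divergence {n : ℕ} {f g : Fin 2 → Fin (n + 1 + 1) → R}
    {φ : Matrix (Fin 2) (Fin 2) R} (hφ : IsUnit φ) {u : R}
    (h : ∀ i, formSubst φ (f i) = u • ∑ j, φ i j • g j) :
    linSubst φ n (divergence f) = C u * divergence g := by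
  have H : ∀ i, linSubst φ (n + 1) (formPoly (f i)) =
      C u * (C (φ i 0) * formPoly (g 0) + C (φ i 1) * formPoly (g 1)) := fun i => by
    rw [← formPoly_formSubst, h i]
    have := formPoly_sum_smul (fun j => u * φ i j) g
    simp only [mul_smul, ← Finset.smul_sum] at this
    rw [this, Fin.sum_univ_two, C_mul, C_mul]
    ring
  have hX : ∀ i, derivative (linSubst φ (n + 1) (formPoly (f i))) = _ := fun i =>
    derivative_linSubst φ (natDegree_formPoly_le (f i))
  have hY : ∀ i, C (n + 1 : R) * linSubst φ (n + 1) (formPoly (f i)) = _ := fun i =>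
    mul_linSubst_eq φ (natDegree_formPoly_le (f i))
      (natDegree_euler_le (natDegree_formPoly_le (f i)))
  have hdet : IsUnit (C φ.det : R[X]) := ((Matrix.isUnit_iff_isUnit_det φ).1 hφ).map C
  have hdet' : (C φ.det : R[X]) = C (φ 0 0) * C (φ 1 1) - C (φ 0 1) * C (φ 1 0) := by
    rw [Matrix.det_fin_two, C_sub, C_mul, C_mul]
  -- The divergence is the trace of the Jacobian, which changes by conjugation with `φ`. Multiplying
  -- by `det φ` replaces `φ⁻¹` by the adjugate, leaving a polynomial identity.
  refine hdet.mul_left_cancel ?_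
  rw [hdet', divergence, divergence, map_add, Nat.cast_add, Nat.cast_one]
  have hX0 := hX 0
  have hX1 := hX 1
  have hY0 := hY 0
  have hY1 := hY 1
  simp only [H, rowForm, derivative_mul, derivative_add, derivative_C, zero_mul, zero_add]
    at hX0 hX1 hY0 hY1
  linear_combination C (φ 0 1) * hX1 - C (φ 1 1) * hX0 - C (φ 0 0) * (hY1 - X * hX1) +
    C (φ 1 0) * (hY0 - X * hX0)

/-- Both summands transform alike: the identity pair `(X, Y)` is carried to `φ (X, Y)`, and the
divergence contributes the factor `u`. -/
theorem formSubst_divTwist {n : ℕ} {f g : Fin 2 → Fin (n + 1 + 1) → R}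
    {φ : Matrix (Fin 2) (Fin 2) R} (hφ : IsUnit φ) {u : R}
    (h : ∀ i, formSubst φ (f i) = u • ∑ j, φ i j • g j) (t : R) (i : Fin 2) :
    formSubst φ (divTwist t f i) = u • ∑ j, φ i j • divTwist t g j := by
  apply formPoly_injective
  have H : ∀ c : Fin 2 → Fin (n + 1 + 1) → R, formPoly (u • ∑ j, φ i j • c j) =
      C u * (C (φ i 0) * formPoly (c 0) + C (φ i 1) * formPoly (c 1)) := fun c => by
    have := formPoly_sum_smul (fun j => u * φ i j) c
    simp only [mul_smul, ← Finset.smul_sum] at this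
    rw [this, Fin.sum_univ_two, C_mul, C_mul]
    ring
  have hrow : linSubst φ (n + 1) (rowForm 1 i * divergence f) =
      rowForm φ i * linSubst φ n (divergence f) := by
    revert i
    rw [Fin.forall_fin_two]
    refine ⟨fun _ => ?_, fun _ => ?_⟩
    · rw [rowForm_one_zero, linSubst_X_mul φ (natDegree_divergence_le f)]
    · rw [rowForm_one_one, one_mul, linSubst_succ φ (natDegree_divergence_le f)]
  rw [formPoly_formSubst, formPoly_divTwist, map_add, linSubst_C_mul, hrow,
    linSubst_divergence hφ h, ← formPoly_formSubst, h, H, H, formPoly_divTwist,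
    formPoly_divTwist, rowForm_one_zero, rowForm_one_one, rowForm]
  ring

/-- The ratio of the resultants of `divTwist t f` and of `f` is invariant under conjugation. -/
theorem formRes_divTwist_mul_formRes {n : ℕ} {f g : Fin 2 → Fin (n + 1 + 1) → R}
    {φ : Matrix (Fin 2) (Fin 2) R} (hφ : IsUnit φ) {u : R} (hu : IsUnit u)
    (h : ∀ i, formSubst φ (f i) = u • ∑ j, φ i j • g j) (t : R) :
    formRes (divTwist t f) * formRes g = formRes (divTwist t g) * formRes f := by
  have hψ : IsUnit (u • φ) := (isUnit_smul_iff hu.unit φ).2 hφ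
  obtain ⟨ω, hω⟩ := exists_formRes_formSubst hφ (n + 1)
  obtain ⟨η, hη⟩ := exists_formRes_sum_smul hψ (n + 1)
  -- The units `ω` and `η` depend only on `φ` and `u`, so they are the same for the original and the
  -- twisted pairs and drop out of the ratio.
  have key : ∀ a b : Fin 2 → Fin (n + 1 + 1) → R,
      (∀ i, formSubst φ (a i) = u • ∑ j, φ i j • b j) → ω * formRes a = η * formRes b := by
    intro a b hab
    rw [← hω, ← hη]
    congr 1
    funext i
    rw [hab i, Finset.smul_sum]
    simp [mul_smul]
  have h₁ := key f g h
  have h₂ := key _ _ (formSubst_divTwist hφ h t)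
  refine η.isUnit.mul_left_cancel ?_
  linear_combination (-formRes (divTwist t f)) * h₁ + formRes f * h₂

end Divergence

/-! ### Homogeneity in the coefficients of the forms. -/

section Homogeneity

variable {σ k : Type*} [CommRing k]

/-- Polynomials over a multivariate polynomial ring with homogeneous coefficients. -/
def HasHomogeneousCoeffs (p : (MvPolynomial σ k)[X]) (n : ℕ) : Prop :=
  ∀ i, (p.coeff i).IsHomogeneous n

theorem HasHomogeneousCoeffs.add {p q : (MvPolynomial σ k)[X]} {n : ℕ}
    (hp : HasHomogeneousCoeffs p n) (hq : HasHomogeneousCoeffs q n) :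
    HasHomogeneousCoeffs (p + q) n := fun i => by
  rw [coeff_add]
  exact (hp i).add (hq i)

theorem HasHomogeneousCoeffs.mul {p q : (MvPolynomial σ k)[X]} {m n : ℕ}
    (hp : HasHomogeneousCoeffs p m) (hq : HasHomogeneousCoeffs q n) :
    HasHomogeneousCoeffs (p * q) (m + n) := fun i => by
  rw [coeff_mul]
  exact MvPolynomial.IsHomogeneous.sum _ _ _ fun x _ => (hp _).mul (hq _)

theorem HasHomogeneousCoeffs.sum {ι : Type*} (s : Finset ι) {p : ι → (MvPolynomial σ k)[X]} {n : ℕ}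
    (hp : ∀ i ∈ s, HasHomogeneousCoeffs (p i) n) : HasHomogeneousCoeffs (∑ i ∈ s, p i) n :=
  fun i => by
    rw [finsetSum_coeff]
    exact MvPolynomial.IsHomogeneous.sum _ _ _ fun x hx => hp x hx i

theorem HasHomogeneousCoeffs.prod {ι : Type*} (s : Finset ι) {p : ι → (MvPolynomial σ k)[X]}
    {n : ℕ} (hp : ∀ i ∈ s, HasHomogeneousCoeffs (p i) n) :
    HasHomogeneousCoeffs (∏ i ∈ s, p i) (s.card * n) := by
  classical
  induction s using Finset.induction with
  | empty =>
    intro i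
    rw [Finset.prod_empty, coeff_one, Finset.card_empty, zero_mul]
    split_ifs
    · exact MvPolynomial.isHomogeneous_one _ _
    · exact MvPolynomial.isHomogeneous_zero _ _ _
  | insert a s ha ih =>
    rw [Finset.prod_insert ha, Finset.card_insert_of_notMem ha, Nat.succ_mul, add_comm]
    exact (hp a (Finset.mem_insert_self _ _)).mul
      (ih fun i hi => hp i (Finset.mem_insert_of_mem hi))

theorem hasHomogeneousCoeffs_map {p : k[X]} :
    HasHomogeneousCoeffs (p.map (MvPolynomial.C : k →+* MvPolynomial σ k)) 0 := fun i => by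
  rw [coeff_map]
  exact MvPolynomial.isHomogeneous_C _ _

theorem hasHomogeneousCoeffs_C {a : MvPolynomial σ k} {n : ℕ} (ha : a.IsHomogeneous n) :
    HasHomogeneousCoeffs (C a) n := fun i => by
  rw [coeff_C]
  split_ifs
  · exact ha
  · exact MvPolynomial.isHomogeneous_zero _ _ _

theorem HasHomogeneousCoeffs.neg {p : (MvPolynomial σ k)[X]} {n : ℕ}
    (hp : HasHomogeneousCoeffs p n) : HasHomogeneousCoeffs (-p) n := fun i => by
  rw [coeff_neg]
  exact (hp i).neg

theorem HasHomogeneousCoeffs.det {ι : Type*} [Fintype ι] [DecidableEq ι]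
    {M : Matrix ι ι (MvPolynomial σ k)[X]} (h : ∀ i j, HasHomogeneousCoeffs (M i j) 1) :
    HasHomogeneousCoeffs M.det (Fintype.card ι) := by
  rw [Matrix.det_apply]
  refine HasHomogeneousCoeffs.sum _ fun τ _ => ?_
  have := HasHomogeneousCoeffs.prod Finset.univ (p := fun i => M (τ i) i) fun i _ => h _ _
  rw [mul_one, Finset.card_univ] at this
  rcases Int.units_eq_one_or (Equiv.Perm.sign τ) with h | h
  · simpa [h] using this
  · simpa [h] using this.neg

theorem hasHomogeneousCoeffs_formRes {d : ℕ} {c : Fin 2 → Fin (d + 1) → (MvPolynomial σ k)[X]}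
    (h : ∀ i j, HasHomogeneousCoeffs (c i j) 1) : HasHomogeneousCoeffs (formRes c) (2 * d) := by
  have h0 : HasHomogeneousCoeffs (0 : (MvPolynomial σ k)[X]) 1 := fun i => by
    rw [coeff_zero]
    exact MvPolynomial.isHomogeneous_zero _ _ _
  have hc : ∀ i n, HasHomogeneousCoeffs ((formPoly (c i)).coeff n) 1 := fun i n => by
    rw [formPoly_coeff]
    split_ifs
    · exact h _ _
    · exact h0
  have := HasHomogeneousCoeffs.det
    (M := sylvester (formPoly (c 0)) (formPoly (c 1)) d d) fun i j => by
      induction j using Fin.addCases <;>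
      · simp only [sylvester, Matrix.of_apply, Fin.addCases_left, Fin.addCases_right]
        split_ifs
        · exact hc _ _
        · exact h0
  rw [two_mul]
  simp only [Fintype.card_fin] at this
  exact this

end Homogeneity

/-! ### Multiplier invariants. -/

section Invariants

/-- The twist is linear in the pair, and `t` has constant coefficients. -/
theorem hasHomogeneousCoeffs_divTwist {k : Type*} [CommRing k] {d : ℕ} (t : k[X])
    (i : Fin 2) (j : Fin (d + 1)) :
    HasHomogeneousCoeffs (divTwist (t.map (MvPolynomial.C : k →+* _))
      (fun i j => C (MvPolynomial.X (i, j) : MvPolynomial (Fin 2 × Fin (d + 1)) k)) i j) 1 := by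
  have h0 : HasHomogeneousCoeffs (0 : (MvPolynomial (Fin 2 × Fin (d + 1)) k)[X]) 1 := fun i => by
    rw [coeff_zero]
    exact MvPolynomial.isHomogeneous_zero _ _ _
  have hnat : ∀ m : ℕ,
      HasHomogeneousCoeffs (m : (MvPolynomial (Fin 2 × Fin (d + 1)) k)[X]) 0 := fun m => by
    simpa using hasHomogeneousCoeffs_map (σ := Fin 2 × Fin (d + 1)) (p := (m : k[X]))
  have hsub : ∀ {p q : (MvPolynomial (Fin 2 × Fin (d + 1)) k)[X]}, HasHomogeneousCoeffs p 1 →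
      HasHomogeneousCoeffs q 1 → HasHomogeneousCoeffs (p - q) 1 := fun hp hq => by
    rw [sub_eq_add_neg]
    exact hp.add hq.neg
  set c : Fin 2 → Fin (d + 1) → (MvPolynomial (Fin 2 × Fin (d + 1)) k)[X] :=
    fun i j => C (MvPolynomial.X (i, j)) with hc
  have hF : ∀ i n, HasHomogeneousCoeffs ((formPoly (c i)).coeff n) 1 := fun i n => by
    rw [formPoly_coeff]
    split_ifs
    · exact hasHomogeneousCoeffs_C (MvPolynomial.isHomogeneous_X _ _)
    · exact h0
  have hF' : ∀ i n, HasHomogeneousCoeffs ((derivative (formPoly (c i))).coeff n) 1 :=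
    fun i n => by
      rw [coeff_derivative]
      exact_mod_cast (hF i (n + 1)).mul (hnat (n + 1))
  have hX : ∀ p : (MvPolynomial (Fin 2 × Fin (d + 1)) k)[X][X],
      (∀ n, HasHomogeneousCoeffs (p.coeff n) 1) →
      ∀ n, HasHomogeneousCoeffs ((X * p).coeff n) 1 := fun p hp n => by
    rcases n with _ | n
    · rw [coeff_X_mul_zero]
      exact h0
    · rw [coeff_X_mul]
      exact hp n
  have hD : ∀ n, HasHomogeneousCoeffs ((divergence c).coeff n) 1 := fun n => by
    rw [divergence, coeff_add, coeff_sub, coeff_C_mul]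
    have h := (hnat d).mul (hF 1 n)
    rw [zero_add] at h
    exact (hF' 0 n).add (hsub h (hX _ (hF' 1) n))
  have h := (hasHomogeneousCoeffs_map (σ := Fin 2 × Fin (d + 1)) (p := t)).mul (hF i j)
  rw [zero_add] at h
  rw [divTwist, coeff_add, coeff_C_mul]
  refine h.add ?_
  revert i
  rw [Fin.forall_fin_two, rowForm_one_zero, rowForm_one_one, one_mul]
  exact ⟨fun _ => hX _ hD _, fun _ => hD _⟩

variable {k : Type*} [Field k]

/-- The polynomial in `s` with value `∏ (s - (1 - λ_P))` at `s`, up to normalization and a fixed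
factor, where `λ_P` runs through the multipliers of the fixed points. -/
noncomputable def multiplierPoly {d : ℕ} (c : Fin 2 → Fin (d + 1) → k) : k[X] :=
  formRes (divTwist (X - C (d + 1 : k)) fun i j => C (c i j))

/-- The generic `multiplierPoly`, with the coefficients of the forms as indeterminates. -/
noncomputable def genericMultiplierPoly (k : Type*) [Field k] (d : ℕ) :
    (MvPolynomial (Fin 2 × Fin (d + 1)) k)[X] :=
  formRes (divTwist ((X - C (d + 1 : k)).map MvPolynomial.C) fun i j => C (MvPolynomial.X (i, j)))

theorem isHomogeneous_coeff_genericMultiplierPoly (d j : ℕ) :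
    ((genericMultiplierPoly k d).coeff j).IsHomogeneous (2 * d) :=
  hasHomogeneousCoeffs_formRes (hasHomogeneousCoeffs_divTwist _) j

theorem eval_coeff_genericMultiplierPoly {d : ℕ} (j : ℕ) (c : Fin 2 → Fin (d + 1) → k) :
    MvPolynomial.eval (fun ij => c ij.1 ij.2) ((genericMultiplierPoly k d).coeff j) =
      (multiplierPoly c).coeff j := by
  rw [multiplierPoly, genericMultiplierPoly, ← coeff_map, ← coe_mapRingHom, ← formRes_map,
    ← divTwist_map]
  congr 3
  · simp
  · simp

/-- The coefficients of `multiplierPoly`, normalized by the resultant, as functions on `End_d`. -/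
noncomputable def multiplierCoeff (k : Type*) [Field k] (d j : ℕ) (f : EndLift k d) : k :=
  (multiplierPoly f.1).coeff j / formRes f.1

/-- Numerator and resultant both have degree `2 d`, which gives regularity; covariance over `k[X]`,
with `φ` and `u` constant, gives invariance. -/
theorem multiplierCoeff_mem (n j : ℕ) :
    multiplierCoeff k (n + 1) j ∈ moduliCoordRing k (n + 1) := by
  refine ⟨⟨1, (genericMultiplierPoly k (n + 1)).coeff j, ?_, fun f => ?_⟩, ?_⟩
  · rw [mul_one]
    exact isHomogeneous_coeff_genericMultiplierPoly (n + 1) j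
  · rw [eval_coeff_genericMultiplierPoly, pow_one, multiplierCoeff]
  · rintro f g ⟨φ, u, h⟩
    have hφ : IsUnit ((φ : Matrix (Fin 2) (Fin 2) k).map (C : k →+* k[X])) :=
      φ.isUnit.map (C : k →+* k[X]).mapMatrix
    have hu : IsUnit (C (u : k)) := u.isUnit.map C
    have hC : ∀ i, formSubst ((φ : Matrix (Fin 2) (Fin 2) k).map (C : k →+* k[X]))
        (fun j => C (f.1 i j)) = C (u : k) • ∑ j, (φ : Matrix (Fin 2) (Fin 2) k).map
          (C : k →+* k[X]) i j • fun l => C (g.1 j l) := fun i => by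
      have hS : formSubst ((φ : Matrix (Fin 2) (Fin 2) k).map (C : k →+* k[X]))
          (fun j => C (f.1 i j)) = fun j => C (formSubst φ (f.1 i) j) := by
        funext j
        simp only [formSubst]
        rw [← coeff_map]
        simp [Polynomial.map_sum]
      rw [hS, h i]
      funext l
      simp
    have key := formRes_divTwist_mul_formRes hφ hu hC (X - C ((n + 1 : ℕ) + 1 : k))
    rw [formRes_map, formRes_map] at key
    have := congrArg (fun p => p.coeff j) key
    simp only [coeff_mul_C] at this
    rw [multiplierCoeff, multiplierCoeff, div_eq_div_iff f.2 g.2]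
    exact this

end Invariants

/-! ### The family `c / G`. -/

section Family

variable {R : Type*} [CommRing R] {d : ℕ}

/-- The pair of forms `c Y^d` and `X^d + b_{d-1} X^{d-1} Y + ⋯ + b_0 Y^d`. -/
def recipFamily (c : R) (b : Fin d → R) : Fin 2 → Fin (d + 1) → R :=
  ![Pi.single 0 c, Fin.snoc b 1]

theorem recipFamily_map {S : Type*} [CommRing S] (h : R →+* S) (c : R) (b : Fin d → R) :
    (fun i j => h (recipFamily c b i j)) = recipFamily (h c) fun j => h (b j) := by
  funext i j
  revert i
  rw [Fin.forall_fin_two]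
  constructor
  · simp [recipFamily, Pi.single_apply, apply_ite h]
  · refine Fin.lastCases ?_ (fun j => ?_) j <;> simp [recipFamily]

theorem formPoly_recipFamily_zero (c : R) (b : Fin d → R) :
    formPoly (recipFamily c b 0) = C c := by
  ext n
  rw [formPoly_coeff, coeff_C]
  split_ifs with h h' h'
  · subst h'
    simp [recipFamily]
  · simp [recipFamily, Fin.ext_iff, h']
  · omega
  · rfl

theorem coeff_formPoly_recipFamily_one (c : R) (b : Fin d → R) :
    (formPoly (recipFamily c b 1)).coeff d = 1 := by
  rw [formPoly_coeff, dif_pos (Nat.lt_succ_self d)]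
  exact Fin.snoc_last (α := fun _ => R) 1 b

theorem formRes_recipFamily (c : R) (b : Fin d → R) :
    formRes (recipFamily c b) = (-1) ^ (d * d) * c ^ d := by
  rw [formRes, formPoly_recipFamily_zero, resultant_C_left, coeff_formPoly_recipFamily_one,
    one_pow, mul_one]

/-- The endomorphism `c / (x^d + b_{d-1} x^{d-1} + ⋯ + b_0)`. -/
noncomputable def recipLift {k : Type*} [Field k] {d : ℕ} {c : k} (hc : c ≠ 0) (b : Fin d → k) :
    EndLift k d :=
  ⟨recipFamily c b, by
    rw [formRes_recipFamily]
    exact mul_ne_zero (pow_ne_zero _ (neg_ne_zero.2 one_ne_zero)) (pow_ne_zero _ hc)⟩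

theorem formSubst_diagonal (a : R) (c : Fin (d + 1) → R) :
    formSubst (Matrix.diagonal ![a, 1]) c = fun j : Fin (d + 1) => a ^ (j : ℕ) * c j := by
  funext j
  have : ∀ i : Fin (d + 1), C (c i) * (C a * X) ^ (i : ℕ) =
      C (a ^ (i : ℕ) * c i) * X ^ (i : ℕ) := fun i => by
    rw [mul_pow, C_mul, C_pow]
    ring
  simp only [formSubst, Matrix.diagonal_apply_eq, Matrix.cons_val_zero, Matrix.cons_val_one,
    ne_eq, zero_ne_one, one_ne_zero, not_false_eq_true, Matrix.diagonal_apply_ne, C_0, add_zero,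
    zero_mul, zero_add, C_1, one_pow, mul_one, this]
  exact coeff_formPoly (fun i : Fin (d + 1) => a ^ (i : ℕ) * c i) j

theorem formSubst_one (c : Fin (d + 1) → R) : formSubst 1 c = c := by
  apply formPoly_injective
  rw [formPoly_formSubst, linSubst_one (natDegree_formPoly_le c)]

theorem endConj_refl {k : Type*} [Field k] {d : ℕ} (f : EndLift k d) : EndConj f f := by
  refine ⟨1, 1, fun i => ?_⟩
  rw [Units.val_one, formSubst_one, Units.val_one, one_smul]
  simp [Matrix.one_apply]

/-- Scaling the coordinate normalizes the numerator to `1`. -/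
theorem endConj_recipLift {k : Type*} [Field k] {d : ℕ} {a : k} (ha : a ≠ 0)
    (hc : a ^ (d + 1) ≠ 0) (b : Fin d → k) :
    EndConj (recipLift hc b) (recipLift one_ne_zero fun j => a ^ (j : ℕ) * b j / a ^ d) := by
  let φ : GL (Fin 2) k := Matrix.GeneralLinearGroup.mkOfDetNeZero (Matrix.diagonal ![a, 1])
    (by simpa [Matrix.det_diagonal] using ha)
  refine ⟨φ, Units.mk0 (a ^ d) (pow_ne_zero d ha), ?_⟩
  have hφ : (φ : Matrix (Fin 2) (Fin 2) k) = Matrix.diagonal ![a, 1] := rfl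
  rw [hφ, Fin.forall_fin_two]
  simp only [formSubst_diagonal, Fin.sum_univ_two, recipLift, Units.val_mk0]
  constructor
  · funext j
    refine Fin.cases ?_ (fun j => ?_) j
    · simp [recipFamily, pow_succ]
    · simp [recipFamily, Fin.succ_ne_zero]
  · funext j
    refine Fin.lastCases ?_ (fun j => ?_) j
    · simp [recipFamily]
    · simp [recipFamily]
      field_simp

/-- For `Φ = X G - c` split with roots `r i`, the polynomial `multiplierPoly` of `c / G`. -/
theorem multiplierPoly_recipFamily {k : Type*} [Field k] {n : ℕ} {c : k} {b : Fin (n + 1) → k}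
    {r : Fin (n + 1 + 1) → k}
    (h : X * formPoly (recipFamily c b 1) - C c = ∏ i, (X - C (r i))) :
    multiplierPoly (recipFamily c b) = (X - C ((n + 1 : ℕ) + 1 : k)) ^ n *
      ∏ i, (C ((formPoly (recipFamily c b 1)).eval (r i)) * X -
        C ((derivative (∏ i, (X - C (r i)))).eval (r i))) := by
  set G := formPoly (recipFamily c b 1) with hG
  set t : k[X] := X - C ((n + 1 : ℕ) + 1 : k) with ht
  have ht0 : t ≠ 0 := X_sub_C_ne_zero _
  set c' : Fin 2 → Fin (n + 1 + 1) → k[X] := fun i j => C (recipFamily c b i j) with hc'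
  have hc0 : formPoly (c' 0) = C (C c) := by
    rw [hc', ← formPoly_map, formPoly_recipFamily_zero, map_C]
  have hc1 : formPoly (c' 1) = G.map C := by rw [hc', ← formPoly_map]
  set D := divergence c' with hD
  have hD' : D = (C (n + 1 : k) * G - X * derivative G).map C := by
    rw [hD, divergence, hc0, hc1, derivative_C, zero_add, derivative_map]
    simp
  have hp : formPoly (divTwist t c' 0) = C t * C (C c) + X * D := by
    rw [formPoly_divTwist, rowForm_one_zero, hc0]
  have hq : formPoly (divTwist t c' 1) = C t * G.map C + D := by
    rw [formPoly_divTwist, rowForm_one_one, hc1, one_mul]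
  set p := formPoly (divTwist t c' 0) with hp'
  set q := formPoly (divTwist t c' 1) with hq'
  have hpd : p.natDegree ≤ n + 1 := natDegree_formPoly_le _
  have hqd : q.natDegree ≤ n + 1 := natDegree_formPoly_le _
  have hqc : q.coeff (n + 1) = t := by
    rw [hq, coeff_add, coeff_C_mul, coeff_map, hG, coeff_formPoly_recipFamily_one,
      coeff_eq_zero_of_natDegree_lt (Nat.lt_succ_of_le (natDegree_divergence_le c'))]
    simp
  have hΦ : (∏ i, (X - C (C (r i))) : k[X][X]) = X * G.map C - C (C c) := by
    have := congrArg (Polynomial.map (C : k →+* k[X])) h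
    simpa [Polynomial.map_prod] using this.symm
  -- The twist keeps the fixed points: `X q - p = t Φ`. So modulo `q` the form `p` may be replaced
  -- by `-t Φ`, whose roots are known.
  have hpq : p = C (-t) * ∏ i, (X - C (C (r i))) + q * X := by
    rw [hΦ, hp, hq, C_neg]
    ring
  have h₁ : resultant p q (n + 1 + 1) (n + 1) =
      (-t) ^ (n + 1) * ∏ i, q.eval (C (r i)) := by
    rw [hpq, resultant_add_mul_left _ _ _ _ _ (by rw [natDegree_X, add_comm]) hqd,
      resultant_C_mul_left]
    congr 1
    have hdeg : (∏ i : Fin (n + 1 + 1), (X - C (C (r i)) : k[X][X])).natDegree = n + 1 + 1 := by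
      rw [natDegree_prod_of_monic _ _ fun i _ => monic_X_sub_C _]
      simp
    have := resultant_prod_left Finset.univ (fun i => (X - C (C (r i)) : k[X][X])) q (n + 1)
      (by simp) hqd
    rw [hdeg] at this
    rw [this]
    refine Finset.prod_congr rfl fun i _ => ?_
    rw [natDegree_X_sub_C, resultant_X_sub_C_left _ _ _ hqd]
  -- Here `p` was given formal degree `n + 2`, one too many; this costs, up to sign, the top
  -- coefficient `t` of `q`, so `t ^ n` is left of `t ^ (n + 1)`.
  have h₂ := resultant_succ_left_deg p q (n + 1) (n + 1) hpd
  rw [h₁, hqc] at h₂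
  have hR : multiplierPoly (recipFamily c b) = resultant p q (n + 1) (n + 1) := rfl
  have h₃ : multiplierPoly (recipFamily c b) = t ^ n * ∏ i, q.eval (C (r i)) := by
    rw [hR]
    have h1 : ((-1 : k[X]) ^ (n + 1)) ≠ 0 := pow_ne_zero _ (neg_ne_zero.2 one_ne_zero)
    refine mul_left_cancel₀ (mul_ne_zero h1 ht0) ?_
    rw [← h₂, neg_pow]
    ring
  rw [h₃]
  congr 1
  refine Finset.prod_congr rfl fun i _ => ?_
  rw [hq, hD', eval_add, eval_mul, eval_C, eval_map, eval_map, ← h, eval₂_at_apply, eval₂_at_apply,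
    ht]
  simp
  ring

end Family

/-! ### Parametrization by the fixed points. -/

section Roots

variable {R : Type*} [CommRing R] {d : ℕ}

/-- The monic polynomial with given roots. -/
noncomputable def rootPoly (r : Fin (d + 1) → R) : R[X] := ∏ i, (X - C (r i))

/-- The pair of forms `c Y^d`, `G` such that `X G - c` has the roots `r i`. -/
noncomputable def rootFamily (r : Fin (d + 1) → R) : Fin 2 → Fin (d + 1) → R :=
  recipFamily (-(rootPoly r).coeff 0) fun j => (rootPoly r).coeff (j + 1)

theorem rootPoly_map {S : Type*} [CommRing S] (h : R →+* S) (r : Fin (d + 1) → R) :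
    (rootPoly r).map h = rootPoly fun i => h (r i) := by
  simp [rootPoly, Polynomial.map_prod]

theorem rootFamily_map {S : Type*} [CommRing S] (h : R →+* S) (r : Fin (d + 1) → R) :
    (fun i j => h (rootFamily r i j)) = rootFamily fun i => h (r i) := by
  rw [rootFamily, recipFamily_map, rootFamily, ← rootPoly_map]
  simp

theorem monic_rootPoly (r : Fin (d + 1) → R) : (rootPoly r).Monic :=
  monic_prod_of_monic _ _ fun i _ => monic_X_sub_C (r i)

theorem natDegree_rootPoly [Nontrivial R] (r : Fin (d + 1) → R) :
    (rootPoly r).natDegree = d + 1 := by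
  rw [rootPoly, natDegree_prod_of_monic _ _ fun i _ => monic_X_sub_C (r i)]
  simp

theorem X_mul_formPoly_rootFamily_sub [Nontrivial R] (r : Fin (d + 1) → R) :
    X * formPoly (rootFamily r 1) - C (-(rootPoly r).coeff 0) = rootPoly r := by
  ext n
  rcases n with _ | n
  · simp
  · rw [coeff_sub, coeff_X_mul, coeff_C_succ, sub_zero, formPoly_coeff]
    split_ifs with hn
    · rcases (Nat.lt_succ_iff.1 hn).eq_or_lt with rfl | h
      · have := (monic_rootPoly r).coeff_natDegree
        rw [natDegree_rootPoly] at this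
        rw [this]
        exact Fin.snoc_last (n := n) (α := fun _ => R) 1
          fun j => (rootPoly r).coeff (j + 1)
      · exact Fin.snoc_castSucc (α := fun _ => R) _
          (fun j : Fin d => (rootPoly r).coeff (j + 1)) ⟨n, h⟩
    · rw [coeff_eq_zero_of_natDegree_lt]
      rw [natDegree_rootPoly]
      omega

variable {k : Type*} [Field k]

theorem neg_coeff_zero_rootPoly_ne_zero {r : Fin (d + 1) → k} (hr : ∀ i, r i ≠ 0) :
    -(rootPoly r).coeff 0 ≠ 0 := by
  rw [neg_ne_zero, coeff_zero_eq_eval_zero, rootPoly, eval_prod]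
  exact Finset.prod_ne_zero_iff.2 fun i _ => by simpa using hr i

/-- The endomorphism `c / G` such that `X G - c` has the nonzero roots `r i`. -/
noncomputable def rootLift (r : Fin (d + 1) → k) (hr : ∀ i, r i ≠ 0) : EndLift k d :=
  recipLift (neg_coeff_zero_rootPoly_ne_zero hr) fun j => (rootPoly r).coeff (j + 1)

theorem rootLift_val (r : Fin (d + 1) → k) (hr : ∀ i, r i ≠ 0) :
    (rootLift r hr).1 = rootFamily r := rfl

theorem eval_derivative_rootPoly (r : Fin (d + 1) → k) (i : Fin (d + 1)) :
    (derivative (rootPoly r)).eval (r i) = ∏ j ∈ Finset.univ.erase i, (r i - r j) := by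
  have := Lagrange.eval_nodal_derivative_eval_node_eq (v := r) (Finset.mem_univ i)
  rw [Lagrange.nodal, Lagrange.eval_nodal] at this
  exact this

theorem multiplierPoly_rootFamily {n : ℕ} (r : Fin (n + 1 + 1) → k) :
    multiplierPoly (rootFamily r) = (X - C ((n + 1 : ℕ) + 1 : k)) ^ n *
      ∏ i, (C ((formPoly (rootFamily r 1)).eval (r i)) * X -
        C (∏ j ∈ Finset.univ.erase i, (r i - r j))) := by
  simp_rw [← eval_derivative_rootPoly]
  exact multiplierPoly_recipFamily (X_mul_formPoly_rootFamily_sub r)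

theorem eval_formPoly_rootFamily_ne_zero {r : Fin (d + 1) → k} (hr : ∀ i, r i ≠ 0)
    (i : Fin (d + 1)) : (formPoly (rootFamily r 1)).eval (r i) ≠ 0 := by
  intro h
  have := congrArg (eval (r i)) (X_mul_formPoly_rootFamily_sub r)
  have hz : (rootPoly r).eval (r i) = 0 := by
    rw [rootPoly, eval_prod]
    exact Finset.prod_eq_zero (Finset.mem_univ i) (by simp)
  rw [eval_sub, eval_mul, h, mul_zero, eval_C, hz, zero_sub, neg_eq_zero] at this
  exact neg_coeff_zero_rootPoly_ne_zero hr this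

/-- Each of the `m + 2 ≥ 2` coinciding roots is a multiple root of `X G - c`, so its linear factor
loses its constant term. -/
theorem X_pow_dvd_multiplierPoly {n m : ℕ} (hm : m < n + 1) {r : Fin (n + 1 + 1) → k}
    (h : ∀ i : Fin (n + 1 + 1), (i : ℕ) < m + 2 → r i = 1) :
    X ^ (m + 2) ∣ multiplierPoly (rootFamily r) := by
  rw [multiplierPoly_rootFamily]
  refine Dvd.dvd.mul_left ?_ _
  let s : Finset (Fin (n + 1 + 1)) := Finset.univ.filter fun i => (i : ℕ) < m + 2
  have hs : s.card = m + 2 := by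
    rw [Fin.card_filter_val_lt]
    omega
  refine dvd_trans ?_ (Finset.prod_dvd_prod_of_subset s Finset.univ _ (Finset.subset_univ s))
  rw [← hs, ← Finset.prod_const]
  refine Finset.prod_dvd_prod_of_dvd _ _ fun i hi => ?_
  have hi' : (i : ℕ) < m + 2 := (Finset.mem_filter.1 hi).2
  obtain ⟨j, hj, hji⟩ : ∃ j : Fin (n + 1 + 1), (j : ℕ) < m + 2 ∧ j ≠ i := by
    by_cases h0 : i = 0
    · exact ⟨1, by simp, by simp [h0]⟩
    · exact ⟨0, by simp, Ne.symm h0⟩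
  rw [Finset.prod_eq_zero (Finset.mem_erase.2 ⟨hji, Finset.mem_univ j⟩)
    (by rw [h i hi', h j hj, sub_self]), C_0, sub_zero]
  exact dvd_mul_left _ _

/-- Simple roots give factors prime to `X`, as does `X - (d + 1)` in characteristic zero; at most
`m` linear factors remain. -/
theorem not_X_pow_dvd_multiplierPoly [CharZero k] {n m : ℕ} {r : Fin (n + 1 + 1) → k}
    (hr : ∀ i, r i ≠ 0) (h : ∀ i j : Fin (n + 1 + 1), m ≤ (i : ℕ) → j ≠ i → r j ≠ r i) :
    ¬ X ^ (m + 1) ∣ multiplierPoly (rootFamily r) := by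
  rw [multiplierPoly_rootFamily]
  let F : Fin (n + 1 + 1) → k[X] := fun i => C ((formPoly (rootFamily r 1)).eval (r i)) * X -
    C (∏ j ∈ Finset.univ.erase i, (r i - r j))
  have hF : ∀ i, F i ≠ 0 := fun i hi => eval_formPoly_rootFamily_ne_zero hr i <| by
    have := congrArg (fun p => coeff p 1) hi
    simp only [F, coeff_sub, coeff_C_mul, coeff_X_one, mul_one, coeff_zero] at this
    rwa [coeff_C_of_ne_zero one_ne_zero, sub_zero] at this
  let s : Finset (Fin (n + 1 + 1)) := Finset.univ.filter fun i => (i : ℕ) < m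
  have hs : s.card ≤ m := by
    rw [Fin.card_filter_val_lt]
    omega
  intro hdvd
  change X ^ (m + 1) ∣ _ * ∏ i, F i at hdvd
  rw [← Finset.prod_mul_prod_compl s] at hdvd
  have hX : Prime (X : k[X]) := prime_X
  have h₁ := hX.pow_dvd_of_dvd_mul_left _ (fun hd => by
    have := hX.dvd_of_dvd_pow hd
    rw [X_dvd_iff] at this
    simp only [coeff_sub, coeff_X_zero, coeff_C_zero, zero_sub, neg_eq_zero] at this
    exact Nat.cast_add_one_ne_zero (n + 1) this) hdvd
  have h₂ := hX.pow_dvd_of_dvd_mul_right _ (fun hd => by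
    obtain ⟨i, hi, hd⟩ := hX.exists_mem_finset_dvd hd
    have hi' : m ≤ (i : ℕ) := by simpa [s] using hi
    rw [X_dvd_iff] at hd
    simp only [F, coeff_sub, coeff_C_mul, coeff_X_zero, mul_zero, coeff_C_zero, zero_sub,
      neg_eq_zero, Finset.prod_eq_zero_iff, Finset.mem_erase, Finset.mem_univ, and_true] at hd
    obtain ⟨j, hj, hd⟩ := hd
    exact h i j hi' hj (sub_eq_zero.1 hd).symm) h₁
  have h₃ := natDegree_le_of_dvd h₂ (Finset.prod_ne_zero_iff.2 fun i _ => hF i)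
  rw [natDegree_X_pow] at h₃
  have h₄ : (∏ i ∈ s, F i).natDegree ≤ ∑ i ∈ s, 1 :=
    (natDegree_prod_le s F).trans (Finset.sum_le_sum fun i _ =>
      natDegree_sub_le_of_le ((natDegree_C_mul_le _ _).trans natDegree_X_le)
        ((natDegree_C _).le.trans zero_le_one))
  rw [Finset.sum_const, smul_eq_mul, mul_one] at h₄
  omega

end Roots

/-! ### The chain of prime ideals. -/

section Strata

variable {k : Type*} [Field k] {d : ℕ}

theorem MvPolynomial.eval_aeval {σ τ : Type*} (r : τ → k) (g : σ → MvPolynomial τ k)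
    (P : MvPolynomial σ k) :
    MvPolynomial.eval r (MvPolynomial.aeval g P) =
      MvPolynomial.eval (fun i => MvPolynomial.eval r (g i)) P := by
  induction P using MvPolynomial.induction_on with
  | C a => simp
  | add p q hp hq => rw [map_add, map_add, map_add, hp, hq]
  | mul_X p i hp => rw [map_mul, map_mul, map_mul, hp, MvPolynomial.aeval_X, MvPolynomial.eval_X]

/-- The denominator, a power of the resultant, never vanishes, so only the numerator of `h` matters,
pulled back to the roots. -/
theorem exists_eval_eq_zero_iff {h : EndLift k d → k} (hh : h ∈ endCoordRing k d) :
    ∃ Q : MvPolynomial (Fin (d + 1)) k, ∀ r (hr : ∀ i, r i ≠ 0),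
      h (rootLift r hr) = 0 ↔ MvPolynomial.eval r Q = 0 := by
  obtain ⟨N, P, -, hP⟩ := hh
  refine ⟨MvPolynomial.aeval (fun ij => rootFamily (MvPolynomial.X : Fin (d + 1) →
    MvPolynomial (Fin (d + 1)) k) ij.1 ij.2) P, fun r hr => ?_⟩
  rw [hP, div_eq_zero_iff, or_iff_left (pow_ne_zero _ (rootLift r hr).2), rootLift_val]
  have := rootFamily_map (MvPolynomial.eval r) (MvPolynomial.X : Fin (d + 1) → _)
  simp only [MvPolynomial.eval_X] at this
  rw [← this]
  rw [MvPolynomial.eval_aeval]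

/-- The ideal of invariant functions that vanish at all `rootLift r` with `r i = 1` for `i < m`. -/
noncomputable def strataIdeal (k : Type*) [Field k] (d m : ℕ) : Ideal (moduliCoordRing k d) where
  carrier := {h | ∀ r (hr : ∀ i, r i ≠ 0), (∀ i : Fin (d + 1), (i : ℕ) < m → r i = 1) →
    h.1 (rootLift r hr) = 0}
  zero_mem' _ _ _ := rfl
  add_mem' {a b} ha hb r hr h := by
    change a.1 (rootLift r hr) + b.1 (rootLift r hr) = 0
    rw [ha r hr h, hb r hr h, add_zero]
  smul_mem' c a ha r hr h := by
    change c.1 (rootLift r hr) * a.1 (rootLift r hr) = 0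
    rw [ha r hr h, mul_zero]

theorem strataIdeal_mono : Monotone (strataIdeal k d) := fun _ _ hm _ hh r hr h =>
  hh r hr fun i hi => h i (hi.trans_le hm)

/-- Replaces the first `m` entries of a tuple by `1`. -/
def oneBelow (m : ℕ) (r : Fin (d + 1) → k) : Fin (d + 1) → k :=
  fun i => if (i : ℕ) < m then 1 else r i

theorem oneBelow_ne_zero (m : ℕ) {r : Fin (d + 1) → k} (hr : ∀ i, r i ≠ 0) (i : Fin (d + 1)) :
    oneBelow m r i ≠ 0 := by
  unfold oneBelow
  split_ifs
  · exact one_ne_zero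
  · exact hr i

theorem mem_strataIdeal_iff_oneBelow {m : ℕ} {h : moduliCoordRing k d} :
    h ∈ strataIdeal k d m ↔ ∀ r (hr : ∀ i, r i ≠ 0),
      h.1 (rootLift (oneBelow m r) (oneBelow_ne_zero m hr)) = 0 := by
  refine ⟨fun hh r hr => hh _ _ fun i hi => if_pos hi, fun hh r hr h1 => ?_⟩
  have : oneBelow m r = r := funext fun i => by
    unfold oneBelow
    split_ifs with hi
    · exact (h1 i hi).symm
    · rfl
  simpa only [this] using hh r hr

theorem exists_mem_strataIdeal_iff [Infinite k] (m : ℕ) (h : moduliCoordRing k d) :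
    ∃ Q : MvPolynomial (Fin (d + 1)) k, (h ∈ strataIdeal k d m ↔ Q = 0) ∧
      ∀ r (hr : ∀ i, r i ≠ 0), h.1 (rootLift (oneBelow m r) (oneBelow_ne_zero m hr)) = 0 ↔
        MvPolynomial.eval r Q = 0 := by
  obtain ⟨Q, hQ⟩ := exists_eval_eq_zero_iff h.2.1
  have key : ∀ r (hr : ∀ i, r i ≠ 0),
      h.1 (rootLift (oneBelow m r) (oneBelow_ne_zero m hr)) = 0 ↔
        MvPolynomial.eval r (MvPolynomial.aeval (fun i : Fin (d + 1) =>
          if (i : ℕ) < m then 1 else (MvPolynomial.X i : MvPolynomial (Fin (d + 1)) k)) Q) = 0 := by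
    intro r hr
    rw [hQ, MvPolynomial.eval_aeval]
    simp only [apply_ite (MvPolynomial.eval r), map_one, MvPolynomial.eval_X]
    rfl
  refine ⟨_, ⟨fun hh => ?_, fun hh => ?_⟩, key⟩
  · refine MvPolynomial.funext_set (fun _ => {0}ᶜ)
      (fun _ => (Set.finite_singleton 0).infinite_compl) fun r hr => ?_
    have hr' : ∀ i, r i ≠ 0 := fun i => hr i trivial
    rw [map_zero, ← key r hr']
    exact mem_strataIdeal_iff_oneBelow.1 hh r hr'
  · refine mem_strataIdeal_iff_oneBelow.2 fun r hr => ?_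
    rw [key r hr, hh, map_zero]

/-- A polynomial that vanishes at all points with nonzero coordinates is zero, so primality comes
from the polynomial ring being a domain. -/
theorem isPrime_strataIdeal (k : Type*) [Field k] [Infinite k] (d m : ℕ) :
    (strataIdeal k d m).IsPrime := by
  refine Ideal.isPrime_iff.2 ⟨fun h => ?_, fun {a b} hab => ?_⟩
  · have := (Ideal.eq_top_iff_one _).1 h (fun _ => 1) (fun _ => one_ne_zero) fun _ _ => rfl
    exact one_ne_zero this
  · obtain ⟨P, hP, hP'⟩ := exists_mem_strataIdeal_iff m a
    obtain ⟨Q, hQ, hQ'⟩ := exists_mem_strataIdeal_iff m b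
    rw [hP, hQ, ← mul_eq_zero]
    refine MvPolynomial.funext_set (fun _ => {0}ᶜ)
      (fun _ => (Set.finite_singleton 0).infinite_compl) fun r hr => ?_
    have hr' : ∀ i, r i ≠ 0 := fun i => hr i trivial
    have := mem_strataIdeal_iff_oneBelow.1 hab r hr'
    rw [map_zero, map_mul, mul_eq_zero, ← hP' r hr', ← hQ' r hr']
    exact mul_eq_zero.1 this

/-- The low coefficients of the multiplier polynomial vanish on the smaller stratum, but not all of
them vanish at a point of the larger one with no further collision. -/
theorem strataIdeal_lt [CharZero k] {n m : ℕ} (hm : m < n + 1) :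
    strataIdeal k (n + 1) (m + 1) < strataIdeal k (n + 1) (m + 2) := by
  refine lt_of_le_not_ge (strataIdeal_mono (Nat.le_succ _)) fun hle => ?_
  -- The entries after the ones are `m + 2, m + 3, …`, distinct and different from `1` in
  -- characteristic zero.
  let r : Fin (n + 1 + 1) → k := fun i => if (i : ℕ) < m + 1 then 1 else ((i + 1 : ℕ) : k)
  have hr : ∀ i, r i ≠ 0 := fun i => by
    simp only [r]
    split_ifs
    · exact one_ne_zero
    · exact Nat.cast_ne_zero.2 (Nat.succ_ne_zero _)
  refine not_X_pow_dvd_multiplierPoly (m := m + 1) hr (fun i j hi hj hji => ?_) ?_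
  · have hi' : ¬ (i : ℕ) < m + 1 := by omega
    simp only [r, if_neg hi'] at hji
    split_ifs at hji
    · have := Nat.cast_injective (R := k) (Nat.cast_one.trans hji)
      omega
    · have := Nat.cast_injective hji
      exact hj (Fin.ext (by omega))
  · rw [X_pow_dvd_iff]
    intro j hj
    have hmem : (⟨multiplierCoeff k (n + 1) j, multiplierCoeff_mem n j⟩ :
        moduliCoordRing k (n + 1)) ∈ strataIdeal k (n + 1) (m + 2) := fun r' hr' h' => by
      change (multiplierPoly (rootFamily r')).coeff j / _ = 0
      rw [X_pow_dvd_iff.1 (X_pow_dvd_multiplierPoly hm h') j hj, zero_div]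
    have := hle hmem r hr fun i hi => if_pos hi
    exact (div_eq_zero_iff.1 this).resolve_right (rootLift r hr).2

end Strata

/-! ### Dimension of a closure from a chain of primes. -/

section Dimension

/-- Closed sets are stable under specialization, so the smallest prime brings the whole chain into
the closure. -/
theorem length_le_topologicalKrullDim_closure {A : Type*} [CommRing A] {Z : Set (PrimeSpectrum A)}
    {n : ℕ} {p : Fin (n + 1) → PrimeSpectrum A} (hp : StrictMono p) (h0 : p 0 ∈ closure Z) :
    (n : WithBot ℕ∞) ≤ topologicalKrullDim (closure Z) := by
  set I := PrimeSpectrum.vanishingIdeal Z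
  rw [← PrimeSpectrum.zeroLocus_vanishingIdeal_eq_closure] at h0 ⊢
  have hle : ringKrullDim (A ⧸ I) ≤
      topologicalKrullDim (PrimeSpectrum.zeroLocus (I : Set A)) := by
    rw [← PrimeSpectrum.topologicalKrullDim_eq_ringKrullDim]
    have hemb := PrimeSpectrum.isClosedEmbedding_comap_of_surjective (A ⧸ I)
      (Ideal.Quotient.mk I) Ideal.Quotient.mk_surjective
    have hmem : ∀ x, PrimeSpectrum.comap (Ideal.Quotient.mk I) x ∈
        PrimeSpectrum.zeroLocus (I : Set A) := fun x => by
      intro a ha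
      change Ideal.Quotient.mk I a ∈ x.asIdeal
      rw [Ideal.Quotient.eq_zero_iff_mem.2 ha]
      exact zero_mem _
    exact (hemb.isInducing.codRestrict hmem).topologicalKrullDim_le
  refine le_trans ?_ hle
  rw [ringKrullDim_quotient]
  let q : LTSeries (PrimeSpectrum.zeroLocus (I : Set A)) :=
    LTSeries.mk n (fun i => ⟨p i, (PrimeSpectrum.mem_zeroLocus _ _).2
      (subset_trans ((PrimeSpectrum.mem_zeroLocus _ _).1 h0) (hp.monotone (Fin.zero_le i)))⟩)
      fun i j hij => hp hij
  exact Order.LTSeries.length_le_krullDim q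

end Dimension

/-! ### Good reduction and density. -/

section GoodReduction

theorem baseChange_recipLift {k : Type*} [Field k] (L : Type*) [Field L] [Algebra k L] {d : ℕ}
    {c : k} (hc : c ≠ 0) (b : Fin d → k) :
    (recipLift hc b).baseChange L =
      recipLift ((map_ne_zero (algebraMap k L)).2 hc) fun j => algebraMap k L (b j) :=
  Subtype.ext (recipFamily_map (algebraMap k L) c b)

/-- No conjugation or rescaling is needed: the coefficients are integral and the resultant is `±1`.
-/
theorem hasGoodReductionOutside_recipLift {K : Type*} [Field K] [NumberField K] {d : ℕ}
    (S : Set (HeightOneSpectrum (𝓞 K))) (b : Fin d → 𝓞 K) :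
    HasGoodReductionOutside S (recipLift (one_ne_zero (α := K)) fun j => algebraMap _ K (b j)) := by
  refine ⟨_, endConj_refl _, fun v _ => ⟨1, fun i j => ?_, ?_⟩⟩
  · have := congrFun (congrFun (recipFamily_map (algebraMap (𝓞 K) K) 1 b) i) j
    rw [map_one] at this
    rw [Units.val_one, one_mul]
    change v.valuation K (recipFamily 1 (fun j => algebraMap (𝓞 K) K (b j)) i j) ≤ 1
    rw [← this]
    exact v.valuation_le_one _
  · simp only [Units.val_one, one_mul, recipLift]
    change v.valuation K (formRes (recipFamily 1 fun j => algebraMap (𝓞 K) K (b j))) = 1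
    rw [formRes_recipFamily, one_pow, mul_one, map_pow, Valuation.map_neg, map_one, one_pow]

/-- An invariant function that vanishes at the maps with integral coefficients in the family
`1 / G` vanishes on the whole family `c / G`. -/
theorem eq_zero_of_forall_int {k : Type*} [Field k] [IsAlgClosed k] [CharZero k] {d : ℕ}
    {h : EndLift k d → k} (hh : h ∈ moduliCoordRing k d)
    (h0 : ∀ b : Fin d → ℤ, h (recipLift one_ne_zero fun j => (b j : k)) = 0)
    {c : k} (hc : c ≠ 0) (b : Fin d → k) : h (recipLift hc b) = 0 := by
  have h1 : ∀ b : Fin d → k, h (recipLift one_ne_zero b) = 0 := by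
    obtain ⟨N, P, -, hP⟩ := hh.1
    let Q := MvPolynomial.aeval (fun ij => recipFamily (1 : MvPolynomial (Fin d) k)
      MvPolynomial.X ij.1 ij.2) P
    have hQ : ∀ b : Fin d → k, h (recipLift one_ne_zero b) = 0 ↔ MvPolynomial.eval b Q = 0 := by
      intro b
      have := recipFamily_map (MvPolynomial.eval b) 1 (MvPolynomial.X : Fin d → _)
      simp only [MvPolynomial.eval_X, map_one] at this
      rw [hP, div_eq_zero_iff, or_iff_left (pow_ne_zero _ (recipLift one_ne_zero b).2),
        MvPolynomial.eval_aeval]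
      change MvPolynomial.eval (fun ij => recipFamily 1 (fun j => b j) ij.1 ij.2) P = 0 ↔ _
      rw [← this]
    -- Density of `ℤ ^ d` in affine space.
    have : Q = 0 := MvPolynomial.funext_set (fun _ => Set.range (Int.cast : ℤ → k))
      (fun _ => Set.infinite_range_of_injective Int.cast_injective) fun b hb => by
        choose b' hb' using fun i => hb i trivial
        obtain rfl : (fun i => (b' i : k)) = b := funext hb'
        rw [map_zero, ← hQ]
        exact h0 b'
    intro b
    rw [hQ, this, map_zero]
  obtain ⟨a, rfl⟩ := IsAlgClosed.exists_pow_nat_eq c (Nat.succ_pos d)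
  rw [hh.2 _ _ (endConj_recipLift (fun ha => hc (by rw [ha, zero_pow (Nat.succ_ne_zero d)])) hc b)]
  exact h1 _

/-- Every stratum lies in the family, on which a function vanishing on the good reduction image is
zero. -/
theorem strataIdeal_mem_closure_goodReductionImage (d m : ℕ)
    (S : Set (HeightOneSpectrum (𝓞 ℚ))) :
    (⟨strataIdeal (AlgebraicClosure ℚ) d m, isPrime_strataIdeal _ d m⟩ :
      ModuliSpace (AlgebraicClosure ℚ) d) ∈ closure (goodReductionImage ℚ S d) := by
  rw [← PrimeSpectrum.zeroLocus_vanishingIdeal_eq_closure, PrimeSpectrum.mem_zeroLocus]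
  intro h hh r hr _
  refine eq_zero_of_forall_int h.2 (fun b => ?_) _ _
  have := PrimeSpectrum.mem_vanishingIdeal _ h |>.1 hh _
    ⟨_, hasGoodReductionOutside_recipLift S fun j => (b j : 𝓞 ℚ), rfl⟩
  change h.1 _ = 0 at this
  rw [baseChange_recipLift] at this
  simpa using this

end GoodReduction

theorem proposition12 (d : ℕ) (hd : 2 ≤ d) : (d : WithBot ℕ∞) ≤ shafDimEmpty d := by
  obtain ⟨n, rfl⟩ : ∃ n, d = n + 1 := ⟨d - 1, by omega⟩
  -- The chain starts at `m = 1`: `m = 0` would add nothing, since scaling already moves one fixed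
  -- point to `1`.
  let p : Fin (n + 1 + 1) → ModuliSpace (AlgebraicClosure ℚ) (n + 1) := fun i =>
    ⟨strataIdeal _ (n + 1) (i + 1), isPrime_strataIdeal _ _ _⟩
  have hp : StrictMono p := Fin.strictMono_iff_lt_succ.2 fun i => strataIdeal_lt i.2
  refine (length_le_topologicalKrullDim_closure hp
    (strataIdeal_mem_closure_goodReductionImage (n + 1) _
      ((∅ : Finset (HeightOneSpectrum (𝓞 ℚ))) : Set (HeightOneSpectrum (𝓞 ℚ))))).trans ?_
  exact le_iSup_of_le ℚ <| le_iSup_of_le inferInstance <| le_iSup_of_le inferInstance <|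
    le_iSup_of_le ∅ le_rfl
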